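/- Let $q\ge 2$ be a fixed integer and $\Sigma_q=\{0,1,\dots,q-1\}$. For a word $x$ over $\Sigma_q$, let $\mathcal B^{\rm ID}_q(x)$ be the set of all words obtained from $x$ by exactly one insertion of a symbol or by exactly one deletion of a symbol. For a code $\mathcal C\subseteq\Sigma_q^n$, let $$\nu(\mathcal C;\mathcal B^{\rm ID}_q)=\max\{|\mathcal B^{\rm ID}_q(x)\cap \mathcal B^{\rm ID}_q(y)| : x,y\in\mathcal C,\ x\neq y\}$$ (with the value $0$ if $|\mathcal C|\le 1$), and for $N\ge 1$ let $$\rho(n,N;\mathcal B^{\rm ID}_q)=\min\{n-\log_q|\mathcal C| : \varnothing\ne\mathcal C\subseteq\Sigma_q^n,\ \nu(\mathcal C;\mathcal B^{\rm ID}_q)<N\}.$$ Then $$\rho(n,N;\mathcal B^{\rm ID}_q)=\begin{cases}\log_q n+\Theta(1), & N\in\{1,2\},\\ \log_q\log_q n+\Theta(1), & N\in\{3,4\},\\ 0\ \text{ for every } n\ge 0, & N\ge 5.\end{cases}$$ Here $\rho=f(n)+\Theta(1)$, with $q$ and $N$ fixed and $n\to\infty$, means that there is a function $\varepsilon(n)=\Theta(1)$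 with $f(n)-\varepsilon(n)\le\rho\le f(n)+\varepsilon(n)$ for all sufficiently large $n$ (that is, $|\rho-f(n)|$ is bounded for large $n$). -/

import Mathlib

namespace SeqRecon

/-- The words of length `n` over the alphabet `Σ_q = {0, 1, …, q - 1}`. -/
abbrev Word (q n : ℕ) : Type := List.Vector (Fin q) n

/-- An error-ball function, assigning to a word the set of its noisy reads (words of any length). -/
abbrev ErrorBall (q : ℕ) : Type := List (Fin q) → Set (List (Fin q))

/-- All words obtained from `x` via exactly one insertion. -/
def insBall (q : ℕ) : ErrorBall q := fun x =>
  {z | ∃ (a b : List (Fin q)) (s : Fin q), x = a ++ b ∧ z = a ++ s :: b}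

/-- All words obtained from `x` via exactly one deletion. -/
def delBall (q : ℕ) : ErrorBall q := fun x =>
  {z | ∃ (a b : List (Fin q)) (s : Fin q), x = a ++ s :: b ∧ z = a ++ b}

/-- The single insertion-or-deletion ball. -/
def insDelBall (q : ℕ) : ErrorBall q := fun x => insBall q x ∪ delBall q x

/-- The read coverage `ν(C; B)`: the largest size of `B(x) ∩ B(y)` over distinct `x, y ∈ C`
(and `0` if there is no such pair). Sizes are taken in `ℕ∞`. -/
noncomputable def readCoverage {q n : ℕ} (C : Finset (Word q n)) (B : ErrorBall q) : ℕ∞ :=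
  ⨆ x ∈ C, ⨆ y ∈ C, ⨆ _ : x ≠ y, (B x.toList ∩ B y.toList).encard

/-- `C` is an `(n, N; B)`-reconstruction code. -/
def IsReconstructionCode {q n : ℕ} (C : Finset (Word q n)) (N : ℕ) (B : ErrorBall q) : Prop :=
  readCoverage C B < (N : ℕ∞)

/-- The redundancies `n - log_q |C|` of the nonempty `(n, N; B)`-reconstruction codes. -/
def redundancies {q : ℕ} (n N : ℕ) (B : ErrorBall q) : Set ℝ :=
  {r | ∃ C : Finset (Word q n), C.Nonempty ∧ IsReconstructionCode C N B ∧
    r = (n : ℝ) - Real.logb (q : ℝ) (C.card : ℝ)}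

/-- The optimal redundancy `ρ(n, N; B)`. The infimum is a minimum, see `redundancy_isLeast`. -/
noncomputable def redundancy {q : ℕ} (n N : ℕ) (B : ErrorBall q) : ℝ :=
  sInf (redundancies n N B)

/-- For a nonempty alphabet and at least one read, the infimum defining `ρ(n, N; B)` is attained. -/
theorem redundancy_isLeast {q : ℕ} (hq : 0 < q) (n N : ℕ) (hN : 0 < N) (B : ErrorBall q) :
    IsLeast (redundancies n N B) (redundancy n N B) := by
  have hfin : (redundancies n N B).Finite := by
    refine (Set.finite_range (fun C : Finset (Word q n) =>
      (n : ℝ) - Real.logb (q : ℝ) (C.card : ℝ))).subset ?_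
    rintro r ⟨C, -, -, rfl⟩
    exact ⟨C, rfl⟩
  have hne : (redundancies n N B).Nonempty := by
    refine ⟨_, {List.Vector.replicate n ⟨0, hq⟩}, Finset.singleton_nonempty _, ?_, rfl⟩
    have h0 : readCoverage {List.Vector.replicate n (⟨0, hq⟩ : Fin q)} B = 0 := by
      simp [readCoverage]
    rw [IsReconstructionCode, h0]
    exact_mod_cast hN
  exact ⟨hne.csInf_mem hfin, fun r hr => csInf_le hfin.bddBelow hr⟩

/-- `r(n) = f(n) + Θ(1)`, in the sense that `f(n) - ε(n) ≤ r(n) ≤ f(n) + ε(n)` for all large `n`,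
for some function `ε(n) = Θ(1)`. -/
def EqUpToThetaOne (r f : ℕ → ℝ) : Prop :=
  ∃ ε : ℕ → ℝ, Asymptotics.IsTheta Filter.atTop ε (fun _ => (1 : ℝ)) ∧
    ∀ᶠ n in Filter.atTop, f n - ε n ≤ r n ∧ r n ≤ f n + ε n

end SeqRecon

/-!
For words of equal length a common read is either longer (a common insertion) or shorter (a common
deletion) than the words, so the number of common reads of `x` and `y` is the number of common
insertions plus the number of common deletions. After removing the common prefix, `x = u a s` and
`y = u b t` with `a ≠ b`, the only candidates are `u b a s`, `u a b t` among the insertions and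
`u t`, `u s` among the deletions. Hence there are at most four common reads, and for `N ≥ 5` every
code works (`redundancy_eq_zero_of_five_le`). Moreover `u b a s` is common exactly if `u t` is, and
`u a b t` exactly if `u s` is.

*One or two reads.* A common insertion forces a common deletion, so having at most one common read
means that the insertion balls are disjoint. These have more than `n` elements, which bounds the
size of the code by a constant times `q ^ n / n` (`card_mul_le_of_disjoint`). Conversely, words with
a common deletion differ by moving one symbol across a factor `m`, possibly changing it. Fixing the
symbol sum modulo `q` makes it the same symbol `a`. Removing `a` from both words gives the same word,
so fixing the parity of the number of descents means that both insertions of `a` create equally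
many (zero or one) descents. In addition the sum of the descents, weighted by their distance to the
end of the word, is fixed modulo `n + 1`. Comparing these sums shows that `a m a` is weakly increasing
or strictly decreasing; the latter is absurd, so `m` is a power of `a`, and the words agree
(`move_eq_of_descents_modEq`).
By pigeonhole some residue class has at least a constant times `q ^ n / n` elements.

*Three or four reads.* If both candidates of one kind are common, then `x` and `y` differ by
interchanging `a` and `b` in an alternating factor `a b a …` (`exists_alternatingSwap`), and if this
factor has length at least two, all four candidates are common reads
(`AlternatingSwap.four_le_encard`). A union bound shows that at least half of all words have only
alternating factors shorter than `K = ⌊log_q n⌋ + 4`. Among these words the symbol sum modulo `q`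
and the position-weighted symbol sum modulo `q K` separate any two words differing by an
alternating swap, and pigeonhole provides a code of size at least a constant times `q ^ n / log n`
with at most two common reads. For the upper bound, the words `(01)^i (10)^(k - i)` with `i ≤ k` pairwise
differ by alternating swaps of length at least two, so a code with at most three common reads
contains at most one word from each family obtained by completing them with the same
prefix and the same suffix. With `k` about `(log_q n) / 4`, all but a fraction `1 / (k + 1)` of
the words have such a word as one of their consecutive blocks of length `2 k`, which gives
`|C| ≤ 2 q ^ n / (k + 1)` (`card_le_of_clique`, `card_mul_log_le_of_encard_le_three`).
-/

namespace SeqRecon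

variable {q : ℕ}

/-! ### Single insertions and deletions -/

theorem mem_insBall_iff_mem_delBall {x z : List (Fin q)} : z ∈ insBall q x ↔ x ∈ delBall q z := by
  constructor
  · rintro ⟨a, b, s, h₁, h₂⟩; exact ⟨a, b, s, h₂, h₁⟩
  · rintro ⟨a, b, s, h₁, h₂⟩; exact ⟨a, b, s, h₂, h₁⟩

theorem length_of_mem_insBall {x z : List (Fin q)} (h : z ∈ insBall q x) :
    z.length = x.length + 1 := by
  obtain ⟨a, b, s, rfl, rfl⟩ := h
  simp; omega

theorem length_of_mem_delBall {x z : List (Fin q)} (h : z ∈ delBall q x) :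
    x.length = z.length + 1 :=
  length_of_mem_insBall (mem_insBall_iff_mem_delBall.2 h)

theorem mem_delBall_cons {a : Fin q} {x z : List (Fin q)} :
    z ∈ delBall q (a :: x) ↔ z = x ∨ ∃ z', z = a :: z' ∧ z' ∈ delBall q x := by
  constructor
  · rintro ⟨u, v, s, h, rfl⟩
    rcases u with _ | ⟨c, u⟩
    · simp only [List.nil_append, List.cons.injEq] at h
      exact Or.inl (by simp [h.2])
    · simp only [List.cons_append, List.cons.injEq] at h
      exact Or.inr ⟨u ++ v, by simp [h.1], u, v, s, h.2, rfl⟩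
  · rintro (rfl | ⟨z', rfl, u, v, s, rfl, rfl⟩)
    · exact ⟨[], z, a, rfl, rfl⟩
    · exact ⟨a :: u, v, s, rfl, rfl⟩

theorem mem_insBall_cons {a : Fin q} {x z : List (Fin q)} :
    z ∈ insBall q (a :: x) ↔
      (∃ c, z = c :: a :: x) ∨ ∃ z', z = a :: z' ∧ z' ∈ insBall q x := by
  constructor
  · rintro ⟨u, v, s, h, rfl⟩
    rcases u with _ | ⟨c, u⟩
    · exact Or.inl ⟨s, by simp_all⟩
    · simp only [List.cons_append, List.cons.injEq] at h
      exact Or.inr ⟨u ++ s :: v, by simp [h.1], u, v, s, h.2, rfl⟩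
  · rintro (⟨c, rfl⟩ | ⟨z', rfl, u, v, s, rfl, rfl⟩)
    · exact ⟨[], a :: x, c, rfl, rfl⟩
    · exact ⟨a :: u, v, s, rfl, rfl⟩

theorem cons_mem_insBall (c : Fin q) (x : List (Fin q)) : c :: x ∈ insBall q x :=
  ⟨[], x, c, rfl, rfl⟩

theorem delBall_inter_cons {a : Fin q} {x y : List (Fin q)} (h : x ≠ y) :
    delBall q (a :: x) ∩ delBall q (a :: y) = List.cons a '' (delBall q x ∩ delBall q y) := by
  ext z
  simp only [Set.mem_inter_iff, mem_delBall_cons, Set.mem_image]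
  constructor
  · rintro ⟨rfl | ⟨z', rfl, hx⟩, h' | ⟨z'', h', hy⟩⟩
    · exact absurd h' h
    · subst h'
      exact ⟨z'', ⟨⟨[], z'', a, rfl, rfl⟩, hy⟩, rfl⟩
    · subst h'
      exact ⟨z', ⟨hx, ⟨[], z', a, rfl, rfl⟩⟩, rfl⟩
    · obtain rfl : z' = z'' := by simpa using h'
      exact ⟨z', ⟨hx, hy⟩, rfl⟩
  · rintro ⟨z', ⟨hx, hy⟩, rfl⟩
    exact ⟨Or.inr ⟨z', rfl, hx⟩, Or.inr ⟨z', rfl, hy⟩⟩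

theorem insBall_inter_cons {a : Fin q} {x y : List (Fin q)} (h : x ≠ y) :
    insBall q (a :: x) ∩ insBall q (a :: y) = List.cons a '' (insBall q x ∩ insBall q y) := by
  ext z
  simp only [Set.mem_inter_iff, mem_insBall_cons, Set.mem_image]
  constructor
  · rintro ⟨⟨c, rfl⟩ | ⟨z', rfl, hx⟩, ⟨d, h'⟩ | ⟨z'', h', hy⟩⟩
    · simp_all
    · simp only [List.cons.injEq] at h'
      obtain ⟨rfl, rfl⟩ := h'
      exact ⟨_, ⟨cons_mem_insBall _ _, hy⟩, rfl⟩
    · simp only [List.cons.injEq] at h'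
      obtain ⟨rfl, rfl⟩ := h'
      exact ⟨_, ⟨hx, cons_mem_insBall _ _⟩, rfl⟩
    · obtain rfl : z' = z'' := by simpa using h'
      exact ⟨z', ⟨hx, hy⟩, rfl⟩
  · rintro ⟨z', ⟨hx, hy⟩, rfl⟩
    exact ⟨Or.inr ⟨z', rfl, hx⟩, Or.inr ⟨z', rfl, hy⟩⟩

theorem delBall_inter_append {u x y : List (Fin q)} (h : x ≠ y) :
    delBall q (u ++ x) ∩ delBall q (u ++ y) = (u ++ ·) '' (delBall q x ∩ delBall q y) := by
  induction u with
  | nil => simp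
  | cons a u ih =>
    rw [List.cons_append, List.cons_append, delBall_inter_cons (by simpa using h), ih,
      Set.image_image]
    rfl

theorem insBall_inter_append {u x y : List (Fin q)} (h : x ≠ y) :
    insBall q (u ++ x) ∩ insBall q (u ++ y) = (u ++ ·) '' (insBall q x ∩ insBall q y) := by
  induction u with
  | nil => simp
  | cons a u ih =>
    rw [List.cons_append, List.cons_append, insBall_inter_cons (by simpa using h), ih,
      Set.image_image]
    rfl

theorem delBall_inter_subset {a b : Fin q} {s t : List (Fin q)} (h : a ≠ b) :
    delBall q (a :: s) ∩ delBall q (b :: t) ⊆ {t, s} := by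
  rintro z ⟨hx, hy⟩
  rw [mem_delBall_cons] at hx hy
  rcases hx with rfl | ⟨z', rfl, -⟩
  · simp
  · rcases hy with rfl | ⟨z'', h', -⟩
    · simp
    · simp_all

theorem insBall_inter_subset {a b : Fin q} {s t : List (Fin q)} (h : a ≠ b) :
    insBall q (a :: s) ∩ insBall q (b :: t) ⊆ {b :: a :: s, a :: b :: t} := by
  rintro z ⟨hx, hy⟩
  rw [mem_insBall_cons] at hx hy
  rcases hx with ⟨c, rfl⟩ | ⟨z', rfl, -⟩
  · rcases hy with ⟨d, h'⟩ | ⟨z'', h', -⟩ <;> simp_all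
  · rcases hy with ⟨d, h'⟩ | ⟨z'', h', -⟩ <;> simp_all

theorem mem_delBall_inter_left {a b : Fin q} {s t : List (Fin q)} :
    t ∈ delBall q (a :: s) ∩ delBall q (b :: t) ↔ t ∈ delBall q (a :: s) :=
  ⟨fun h => h.1, fun h => ⟨h, [], t, b, rfl, rfl⟩⟩

theorem mem_insBall_inter_left {a b : Fin q} {s t : List (Fin q)} (h : a ≠ b) :
    b :: a :: s ∈ insBall q (a :: s) ∩ insBall q (b :: t) ↔ t ∈ delBall q (a :: s) := by
  rw [Set.mem_inter_iff, mem_insBall_cons (a := b), ← mem_insBall_iff_mem_delBall]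
  simp [cons_mem_insBall, h]

theorem exists_eq_append_cons_of_ne {α : Type*} {x y : List α} (hl : x.length = y.length)
    (h : x ≠ y) : ∃ u a b s t, a ≠ b ∧ s.length = t.length ∧ x = u ++ a :: s ∧ y = u ++ b :: t := by
  induction x generalizing y with
  | nil => cases y <;> simp_all
  | cons c x ih =>
    rcases y with _ | ⟨d, y⟩
    · simp at hl
    · by_cases hcd : c = d
      · subst hcd
        obtain ⟨u, a, b, s, t, hab, hst, rfl, rfl⟩ := ih (by simpa using hl) (by simpa using h)
        exact ⟨c :: u, a, b, s, t, hab, hst, rfl, rfl⟩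
      · exact ⟨[], c, d, x, y, hcd, by simpa using hl, rfl, rfl⟩

theorem encard_delBall_inter_append {u x y : List (Fin q)} (h : x ≠ y) :
    (delBall q (u ++ x) ∩ delBall q (u ++ y)).encard = (delBall q x ∩ delBall q y).encard := by
  rw [delBall_inter_append h]
  exact (List.append_right_injective u).encard_image _

theorem encard_insBall_inter_append {u x y : List (Fin q)} (h : x ≠ y) :
    (insBall q (u ++ x) ∩ insBall q (u ++ y)).encard = (insBall q x ∩ insBall q y).encard := by
  rw [insBall_inter_append h]
  exact (List.append_right_injective u).encard_image _

theorem encard_pair_le_two {α : Type*} (p r : α) : ({p, r} : Set α).encard ≤ 2 :=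
  (Set.encard_insert_le _ _).trans (by simp [one_add_one_eq_two])

theorem encard_delBall_inter_le_two {x y : List (Fin q)} (hl : x.length = y.length) (h : x ≠ y) :
    (delBall q x ∩ delBall q y).encard ≤ 2 := by
  obtain ⟨u, a, b, s, t, hab, -, rfl, rfl⟩ := exists_eq_append_cons_of_ne hl h
  rw [encard_delBall_inter_append (by simp [hab])]
  exact (Set.encard_le_encard (delBall_inter_subset hab)).trans (encard_pair_le_two _ _)

theorem encard_insBall_inter_le_two {x y : List (Fin q)} (hl : x.length = y.length) (h : x ≠ y) :
    (insBall q x ∩ insBall q y).encard ≤ 2 := by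
  obtain ⟨u, a, b, s, t, hab, -, rfl, rfl⟩ := exists_eq_append_cons_of_ne hl h
  rw [encard_insBall_inter_append (by simp [hab])]
  exact (Set.encard_le_encard (insBall_inter_subset hab)).trans (encard_pair_le_two _ _)

/-- For words of the same length the common reads split by length: a longer common read comes
from insertions on both sides, a shorter one from deletions on both sides. -/
theorem encard_insDelBall_inter {x y : List (Fin q)} (hl : x.length = y.length) :
    (insDelBall q x ∩ insDelBall q y).encard =
      (insBall q x ∩ insBall q y).encard + (delBall q x ∩ delBall q y).encard := by
  rw [← Set.encard_union_eq]
  · congr 1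
    ext z
    simp only [insDelBall, Set.mem_inter_iff, Set.mem_union]
    constructor
    · rintro ⟨h₁ | h₁, h₂ | h₂⟩
      · exact Or.inl ⟨h₁, h₂⟩
      · have := length_of_mem_insBall h₁; have := length_of_mem_delBall h₂; omega
      · have := length_of_mem_delBall h₁; have := length_of_mem_insBall h₂; omega
      · exact Or.inr ⟨h₁, h₂⟩
    · tauto
  · rw [Set.disjoint_left]
    rintro z ⟨h₁, -⟩ ⟨h₂, -⟩
    have := length_of_mem_insBall h₁; have := length_of_mem_delBall h₂; omega

theorem delBall_inter_nonempty_of_insBall {x y : List (Fin q)} (hl : x.length = y.length)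
    (h : x ≠ y) (hI : (insBall q x ∩ insBall q y).Nonempty) :
    (delBall q x ∩ delBall q y).Nonempty := by
  obtain ⟨u, a, b, s, t, hab, -, rfl, rfl⟩ := exists_eq_append_cons_of_ne hl h
  rw [insBall_inter_append (by simp [hab]), Set.image_nonempty] at hI
  rw [delBall_inter_append (by simp [hab]), Set.image_nonempty]
  obtain ⟨z, hz⟩ := hI
  rcases insBall_inter_subset hab hz with rfl | rfl
  · exact ⟨t, mem_delBall_inter_left.2 ((mem_insBall_inter_left hab).1 hz)⟩
  · rw [Set.inter_comm] at hz ⊢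
    exact ⟨s, mem_delBall_inter_left.2 ((mem_insBall_inter_left hab.symm).1 hz)⟩

/-- Two words with a common deletion differ by moving one symbol across a factor `m`, possibly
changing that symbol. -/
theorem exists_move_of_delBall_inter {x y : List (Fin q)}
    (h : (delBall q x ∩ delBall q y).Nonempty) :
    ∃ u a m b w, (x = u ++ a :: (m ++ w) ∧ y = u ++ (m ++ b :: w)) ∨
      (y = u ++ a :: (m ++ w) ∧ x = u ++ (m ++ b :: w)) := by
  obtain ⟨z, ⟨c, d, a, rfl, rfl⟩, ⟨c', d', b, rfl, h⟩⟩ := h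
  rcases List.append_eq_append_iff.1 h with ⟨m, rfl, rfl⟩ | ⟨m, rfl, rfl⟩
  · exact ⟨c, a, m, b, d', Or.inl ⟨rfl, by simp⟩⟩
  · exact ⟨c', b, m, a, d, Or.inr ⟨rfl, by simp⟩⟩

theorem exists_finset_subset_insBall (hq : 2 ≤ q) (x : List (Fin q)) :
    ∃ S : Finset (List (Fin q)), (S : Set (List (Fin q))) ⊆ insBall q x ∧
      S.card = x.length + 1 := by
  classical
  induction x with
  | nil => exact ⟨{[⟨0, by omega⟩]}, by simpa using cons_mem_insBall _ _, rfl⟩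
  | cons a x ih =>
    obtain ⟨S, hS, hc⟩ := ih
    have : Nontrivial (Fin q) := Fin.nontrivial_iff_two_le.2 hq
    obtain ⟨b, hb⟩ := exists_ne a
    refine ⟨insert (b :: a :: x) (S.map ⟨List.cons a, List.cons_injective⟩), ?_, ?_⟩
    · intro z hz
      simp only [Finset.coe_insert, Finset.coe_map, Function.Embedding.coeFn_mk,
        Set.mem_insert_iff, Set.mem_image] at hz
      rcases hz with rfl | ⟨z', hz', rfl⟩
      · exact cons_mem_insBall _ _
      · exact mem_insBall_cons.2 (Or.inr ⟨z', rfl, hS hz'⟩)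
    · rw [Finset.card_insert_of_notMem (by simp [Ne.symm hb]), Finset.card_map, hc]
      rfl

/-! ### Alternating factors -/

/-- The alternating word `a b a b …` of length `k`. -/
def alternating {α : Type*} (a b : α) : ℕ → List α
  | 0 => []
  | k + 1 => a :: alternating b a k

@[simp] theorem length_alternating {α : Type*} (a b : α) (k : ℕ) :
    (alternating a b k).length = k := by
  induction k generalizing a b with
  | zero => rfl
  | succ k ih => simp [alternating, ih]

theorem alternating_two_mul_add {α : Type*} (a b : α) (i k : ℕ) :
    alternating a b (2 * i + k) = alternating a b (2 * i) ++ alternating a b k := by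
  induction i with
  | zero => simp [alternating]
  | succ i ih =>
    rw [show 2 * (i + 1) + k = 2 * i + k + 1 + 1 by ring, show 2 * (i + 1) = 2 * i + 1 + 1 by ring]
    simp [alternating, ih]

theorem alternating_prefix {α : Type*} (a b : α) {k l : ℕ} (h : k ≤ l) :
    alternating a b k <+: alternating a b l := by
  induction k generalizing a b l with
  | zero => simp [alternating]
  | succ k ih =>
    obtain ⟨l, rfl⟩ : ∃ l', l = l' + 1 := ⟨l - 1, by omega⟩
    simpa [alternating] using ih b a (by omega)

/-- `x` and `y` differ exactly in an alternating factor of length `k`, in which the two symbols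
are interchanged. -/
def AlternatingSwap {α : Type*} (k : ℕ) (x y : List α) : Prop :=
  ∃ u a b w, a ≠ b ∧ x = u ++ (alternating a b k ++ w) ∧ y = u ++ (alternating b a k ++ w)

theorem AlternatingSwap.symm {α : Type*} {k : ℕ} {x y : List α} (h : AlternatingSwap k x y) :
    AlternatingSwap k y x := by
  obtain ⟨u, a, b, w, hab, rfl, rfl⟩ := h
  exact ⟨u, b, a, w, hab.symm, rfl, rfl⟩

theorem AlternatingSwap.append_right {α : Type*} {k : ℕ} {x y : List α}
    (h : AlternatingSwap k x y) (w : List α) : AlternatingSwap k (x ++ w) (y ++ w) := by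
  obtain ⟨u, a, b, w', hab, rfl, rfl⟩ := h
  exact ⟨u, a, b, w' ++ w, hab, by simp, by simp⟩

theorem AlternatingSwap.append_left {α : Type*} {k : ℕ} {x y : List α}
    (h : AlternatingSwap k x y) (u : List α) : AlternatingSwap k (u ++ x) (u ++ y) := by
  obtain ⟨u', a, b, w', hab, rfl, rfl⟩ := h
  exact ⟨u ++ u', a, b, w', hab, by simp, by simp⟩

theorem AlternatingSwap.ne {α : Type*} {k : ℕ} (hk : 0 < k) {x y : List α}
    (h : AlternatingSwap k x y) : x ≠ y := by
  obtain ⟨u, a, b, w', hab, rfl, rfl⟩ := h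
  obtain ⟨k, rfl⟩ : ∃ l, k = l + 1 := ⟨k - 1, by omega⟩
  simp [alternating, hab]

theorem exists_alternating_of_mem_delBall {a b : Fin q} {s t : List (Fin q)}
    (hl : s.length = t.length) (ht : t ∈ delBall q (a :: s)) (hs : s ∈ delBall q (b :: t)) :
    ∃ k w, s = alternating b a k ++ w ∧ t = alternating a b k ++ w := by
  induction s generalizing a b t with
  | nil =>
    obtain rfl : t = [] := List.length_eq_zero_iff.1 (by simpa using hl.symm)
    exact ⟨0, [], rfl, rfl⟩
  | cons c s ih =>
    rw [mem_delBall_cons] at ht hs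
    rcases ht with rfl | ⟨t', rfl, ht⟩
    · exact ⟨0, _, rfl, rfl⟩
    · rcases hs with h | ⟨s', h, hs⟩
      · exact ⟨0, _, rfl, h.symm⟩
      · simp only [List.cons.injEq] at h
        obtain ⟨rfl, rfl⟩ := h
        obtain ⟨k, w, h₁, h₂⟩ := ih (by simpa using hl) ht hs
        exact ⟨k + 1, w, by simp [alternating, h₁], by simp [alternating, h₂]⟩

theorem alternating_append_mem_delBall (a b : Fin q) (k : ℕ) (w : List (Fin q)) :
    alternating b a k ++ w ∈ delBall q (b :: (alternating a b k ++ w)) := by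
  induction k generalizing a b with
  | zero => exact ⟨[], w, b, rfl, rfl⟩
  | succ k ih => exact mem_delBall_cons.2 (Or.inr ⟨_, rfl, ih b a⟩)

theorem mem_of_subset_pair_of_one_lt_encard {α : Type*} {S : Set α} {p r : α} (h : S ⊆ {p, r})
    (hS : 1 < S.encard) : p ∈ S ∧ r ∈ S := by
  constructor
  · by_contra hp
    refine absurd hS (not_lt.2 ((Set.encard_le_encard (t := {r}) ?_).trans (by simp)))
    intro z hz
    rcases h hz with rfl | rfl
    · exact absurd hz hp
    · rfl
  · by_contra hp
    refine absurd hS (not_lt.2 ((Set.encard_le_encard (t := {p}) ?_).trans (by simp)))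
    intro z hz
    rcases h hz with rfl | rfl
    · rfl
    · exact absurd hz hp

/-- Two words having two common insertions, or two common deletions, differ by an alternating
swap. -/
theorem exists_alternatingSwap {x y : List (Fin q)} (hl : x.length = y.length) (h : x ≠ y)
    (h3 : 1 < (insBall q x ∩ insBall q y).encard ∨ 1 < (delBall q x ∩ delBall q y).encard) :
    ∃ k, 0 < k ∧ AlternatingSwap k x y := by
  obtain ⟨u, a, b, s, t, hab, hst, rfl, rfl⟩ := exists_eq_append_cons_of_ne hl h
  have hne : a :: s ≠ b :: t := by simp [hab]
  rw [encard_insBall_inter_append hne, encard_delBall_inter_append hne] at h3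
  have key : t ∈ delBall q (a :: s) ∧ s ∈ delBall q (b :: t) := by
    rcases h3 with h3 | h3
    · obtain ⟨h₁, h₂⟩ := mem_of_subset_pair_of_one_lt_encard (insBall_inter_subset hab) h3
      refine ⟨(mem_insBall_inter_left hab).1 h₁, ?_⟩
      rw [Set.inter_comm] at h₂
      exact (mem_insBall_inter_left hab.symm).1 h₂
    · obtain ⟨h₁, h₂⟩ := mem_of_subset_pair_of_one_lt_encard (delBall_inter_subset hab) h3
      exact ⟨h₁.1, h₂.2⟩
  obtain ⟨k, w, rfl, rfl⟩ := exists_alternating_of_mem_delBall hst key.1 key.2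
  exact ⟨k + 1, by omega, u, a, b, w, hab, rfl, rfl⟩

theorem AlternatingSwap.four_le_encard {k : ℕ} (hk : 2 ≤ k) {x y : List (Fin q)}
    (h : AlternatingSwap k x y) : 4 ≤ (insDelBall q x ∩ insDelBall q y).encard := by
  have hl : x.length = y.length := by
    obtain ⟨u, a, b, w, hab, rfl, rfl⟩ := h; simp
  rw [encard_insDelBall_inter hl]
  obtain ⟨u, a, b, w, hab, rfl, rfl⟩ := h
  obtain ⟨k, rfl⟩ : ∃ l, k = l + 2 := ⟨k - 2, by omega⟩
  have h₁ := alternating_append_mem_delBall a b (k + 1) w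
  have h₂ := alternating_append_mem_delBall b a (k + 1) w
  have hst : alternating b a (k + 1) ++ w ≠ alternating a b (k + 1) ++ w := by
    simp [alternating, hab.symm]
  rw [show k + 2 = k + 1 + 1 from rfl, alternating, alternating]
  set s := alternating b a (k + 1) ++ w
  set t := alternating a b (k + 1) ++ w
  have hne : a :: s ≠ b :: t := by simp [hab]
  simp only [List.cons_append]
  change 4 ≤ (insBall q (u ++ a :: s) ∩ insBall q (u ++ b :: t)).encard +
    (delBall q (u ++ a :: s) ∩ delBall q (u ++ b :: t)).encard
  rw [encard_insBall_inter_append hne, encard_delBall_inter_append hne]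
  have hI : ({b :: a :: s, a :: b :: t} : Set (List (Fin q))) ⊆
      insBall q (a :: s) ∩ insBall q (b :: t) := by
    rintro z (rfl | rfl)
    · exact (mem_insBall_inter_left hab).2 h₂
    · rw [Set.inter_comm]
      exact (mem_insBall_inter_left hab.symm).2 h₁
  have hD : ({t, s} : Set (List (Fin q))) ⊆ delBall q (a :: s) ∩ delBall q (b :: t) := by
    rintro z (rfl | rfl)
    · exact mem_delBall_inter_left.2 h₂
    · rw [Set.inter_comm]
      exact mem_delBall_inter_left.2 h₁
  have hI' := Set.encard_le_encard hI
  have hD' := Set.encard_le_encard hD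
  rw [Set.encard_pair (by simp [hab.symm])] at hI'
  rw [Set.encard_pair hst.symm] at hD'
  calc (4 : ℕ∞) = 2 + 2 := by norm_num
    _ ≤ _ := add_le_add hI' hD'

/-! ### Descent statistics -/

/-- The number of descents `x_i > x_{i+1}` of a word. -/
def descents : List (Fin q) → ℤ
  | [] => 0
  | [_] => 0
  | a :: b :: l => (if b < a then 1 else 0) + descents (b :: l)

/-- The sum of the descents `x_i > x_{i+1}` of a word, each weighted by the length of the suffix
starting at `x_{i+1}`. -/
def weightedDescents : List (Fin q) → ℤ
  | [] => 0
  | [_] => 0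
  | a :: b :: l => (if b < a then (l.length : ℤ) + 1 else 0) + weightedDescents (b :: l)

theorem descents_nonneg (x : List (Fin q)) : 0 ≤ descents x := by
  fun_induction descents x with
  | case1 => simp
  | case2 => simp
  | case3 a b l ih => split_ifs <;> omega

theorem descents_cons_le (a : Fin q) (x : List (Fin q)) : descents (a :: x) ≤ x.length := by
  induction x generalizing a with
  | nil => simp [descents]
  | cons b x ih =>
    have := ih b
    rw [descents, List.length_cons]
    push_cast
    split_ifs <;> omega

theorem descents_insert (a : Fin q) (R m : List (Fin q)) (c : Fin q) :
    descents (c :: (m ++ a :: R)) - descents (c :: (m ++ R)) = 0 ∨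
      descents (c :: (m ++ a :: R)) - descents (c :: (m ++ R)) = 1 := by
  induction m generalizing c with
  | nil =>
    cases R with
    | nil => simp only [List.nil_append, descents]; split_ifs <;> simp
    | cons r R => simp only [List.nil_append, descents]; split_ifs <;> omega
  | cons d m ih =>
    have := ih d
    simp only [List.cons_append, descents]
    omega

/-- The change of the weighted descents under insertion of `a` behind `c :: m`: the descents up to
the new symbol move one step away from the end of the word. -/
theorem weightedDescents_insert (a : Fin q) (R m : List (Fin q)) (c : Fin q) :
    weightedDescents (c :: (m ++ a :: R)) - weightedDescents (c :: (m ++ R)) =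
      R.length * (descents (c :: (m ++ a :: R)) - descents (c :: (m ++ R))) +
        descents (c :: (m ++ [a])) := by
  induction m generalizing c with
  | nil =>
    cases R with
    | nil => simp [descents, weightedDescents]
    | cons r R =>
      simp only [List.nil_append, descents, weightedDescents, List.length_cons]
      push_cast
      split_ifs <;> ring
  | cons d m ih =>
    have := ih d
    simp only [List.cons_append, descents, weightedDescents, List.length_append, List.length_cons]
    push_cast
    split_ifs <;> linarith

theorem eq_replicate_of_descents_eq_zero {a : Fin q} {m : List (Fin q)} {c : Fin q} (hac : a ≤ c)
    (h : descents (c :: (m ++ [a])) = 0) : c = a ∧ m = List.replicate m.length a := by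
  induction m generalizing c with
  | nil =>
    simp only [List.nil_append, descents] at h
    split_ifs at h with h'
    · omega
    · exact ⟨le_antisymm (not_lt.1 h') hac, rfl⟩
  | cons d m ih =>
    simp only [List.cons_append, descents] at h
    have h0 := descents_nonneg (d :: (m ++ [a]))
    split_ifs at h with h'
    · omega
    · have hcd := not_lt.1 h'
      obtain ⟨rfl, hm⟩ := ih (hac.trans hcd) (by omega)
      exact ⟨le_antisymm hcd hac, by rw [List.length_cons, List.replicate_succ, ← hm]⟩

theorem lt_of_descents_eq_length {a : Fin q} {m : List (Fin q)} {c : Fin q}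
    (h : descents (c :: (m ++ [a])) = m.length + 1) : a < c := by
  induction m generalizing c with
  | nil =>
    simp only [List.nil_append, descents] at h
    split_ifs at h with h'
    · exact h'
    · simp at h
  | cons d m ih =>
    simp only [List.cons_append, descents] at h
    have h0 := descents_cons_le d (m ++ [a])
    simp only [List.length_append, List.length_cons, List.length_nil] at h h0
    push_cast at h h0
    split_ifs at h with h'
    · exact (ih (by omega)).trans h'
    · omega

theorem cons_append_eq_append_cons_of_eq_replicate {α : Type*} {a : α} {m : List α}
    (hm : m = List.replicate m.length a) (R : List α) : a :: (m ++ R) = m ++ a :: R := by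
  rw [hm, ← List.cons_append, ← List.replicate_succ, List.replicate_succ', List.append_assoc]
  rfl

/-- A common prefix influences the statistics of words of equal length in the same way, up to
the last symbol `p` of the prefix. -/
theorem exists_descents_append_sub (c : Fin q) (u : List (Fin q)) : ∃ p, ∀ v v' : List (Fin q),
    v.length = v'.length →
      descents (c :: (u ++ v)) - descents (c :: (u ++ v')) =
        descents (p :: v) - descents (p :: v') ∧
      weightedDescents (c :: (u ++ v)) - weightedDescents (c :: (u ++ v')) =
        weightedDescents (p :: v) - weightedDescents (p :: v') := by
  induction u generalizing c with
  | nil => exact ⟨c, fun v v' _ => ⟨rfl, rfl⟩⟩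
  | cons d u ih =>
    obtain ⟨p, hp⟩ := ih d
    refine ⟨p, fun v v' h => ?_⟩
    obtain ⟨h₁, h₂⟩ := hp v v' h
    rw [← h₁, ← h₂]
    simp only [List.cons_append, descents, weightedDescents, List.length_append, h]
    constructor <;> ring

/-- Moving the symbol `a` across `m` changes one of the two statistics, unless it does not change
the word. -/
theorem move_eq_of_descents_modEq {p a : Fin q} {m R : List (Fin q)} {M : ℤ}
    (hM : (m.length : ℤ) + 1 < M)
    (h2 : (2 : ℤ) ∣ descents (p :: a :: (m ++ R)) - descents (p :: (m ++ a :: R)))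
    (hd : M ∣ weightedDescents (p :: a :: (m ++ R)) - weightedDescents (p :: (m ++ a :: R))) :
    a :: (m ++ R) = m ++ a :: R := by
  rcases m with _ | ⟨b, m⟩
  · rfl
  have hB := descents_insert a R (b :: m) p
  have hA := descents_insert a (b :: m ++ R) [] p
  have hF := weightedDescents_insert a R (b :: m) p
  have hF' := weightedDescents_insert a (b :: m ++ R) [] p
  have hdes0 := descents_nonneg (b :: (m ++ [a]))
  have hdes1 := descents_cons_le b (m ++ [a])
  simp only [List.nil_append, List.length_append, List.length_cons, List.length_nil] at *
  push_cast at *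
  -- both words arise from `p :: (b :: m ++ R)` by inserting `a`, and gain the same number of
  -- descents
  have hAB : descents (p :: a :: (b :: m ++ R)) = descents (p :: (b :: m ++ a :: R)) := by omega
  rw [hAB] at hF'
  set D := descents (p :: (b :: m ++ a :: R)) - descents (p :: (b :: m ++ R)) with hD
  have hdiff : weightedDescents (p :: a :: (b :: m ++ R)) -
      weightedDescents (p :: (b :: m ++ a :: R)) =
        (m.length + 1) * D + descents [p, a] - descents (p :: (b :: m ++ [a])) := by linarith
  have hpa : descents [p, a] = if a < p then 1 else 0 := by simp [descents]
  have hDA : D = (if a < p then 1 else 0) + (if b < a then 1 else 0) - if b < p then 1 else 0 := by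
    rw [hD, ← hAB]
    simp only [List.cons_append, descents]
    ring
  have hpm : descents (p :: (b :: m ++ [a])) =
      (if b < p then 1 else 0) + descents (b :: (m ++ [a])) := by
    simp only [List.cons_append, descents]
  rw [hpa, hpm] at hdiff
  have hz : weightedDescents (p :: a :: (b :: m ++ R)) -
      weightedDescents (p :: (b :: m ++ a :: R)) = 0 := by
    refine Int.eq_zero_of_abs_lt_dvd hd ?_
    rw [hdiff, abs_lt]
    rcases hB with h | h <;> rw [h] <;> split_ifs <;> constructor <;> omega
  rw [hz] at hdiff
  have hdes : descents (a :: (b :: m ++ [a])) =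
      (if b < a then 1 else 0) + descents (b :: (m ++ [a])) := by
    simp only [List.cons_append, descents]
  rcases hB with h | h
  · -- no descent is gained: the word `a :: (b :: m ++ [a])` is weakly increasing
    have h0 : descents (a :: (b :: m ++ [a])) = 0 := by
      rw [hdes]; rw [h] at hDA hdiff; split_ifs at hDA hdiff ⊢ <;> omega
    exact cons_append_eq_append_cons_of_eq_replicate
      (eq_replicate_of_descents_eq_zero le_rfl h0).2 R
  · -- a descent is gained: the word `a :: (b :: m ++ [a])` is strictly decreasing
    have h0 : descents (a :: (b :: m ++ [a])) = (b :: m).length + 1 := by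
      rw [hdes, List.length_cons]; rw [h] at hDA hdiff
      push_cast
      split_ifs at hDA hdiff ⊢ <;> omega
    exact absurd (lt_of_descents_eq_length h0) (lt_irrefl _)

/-! ### Symbol sums -/

/-- The sum of the symbols of a word. -/
def symbolSum : List (Fin q) → ℤ
  | [] => 0
  | a :: l => (a : ℕ) + symbolSum l

/-- The sum of the symbols of a word, weighted by their positions counted from the end. -/
def weightedSum : List (Fin q) → ℤ
  | [] => 0
  | a :: l => (a : ℕ) * ((l.length : ℤ) + 1) + weightedSum l

theorem symbolSum_append (u v : List (Fin q)) :
    symbolSum (u ++ v) = symbolSum u + symbolSum v := by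
  induction u with
  | nil => simp [symbolSum]
  | cons a u ih => simp [symbolSum, ih, add_assoc]

theorem weightedSum_append (u v : List (Fin q)) :
    weightedSum (u ++ v) = weightedSum u + v.length * symbolSum u + weightedSum v := by
  induction u with
  | nil => simp [symbolSum, weightedSum]
  | cons a u ih =>
    simp only [List.cons_append, symbolSum, weightedSum, ih, List.length_append]
    push_cast
    ring

theorem symbolSum_alternating_sub (a b : Fin q) (k : ℕ) :
    symbolSum (alternating a b k) - symbolSum (alternating b a k) =
      if Even k then 0 else ((a : ℕ) : ℤ) - (b : ℕ) := by
  induction k generalizing a b with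
  | zero => simp [alternating]
  | succ k ih =>
    have := ih b a
    simp only [alternating, symbolSum, Nat.even_add_one]
    split_ifs at this ⊢ <;> first | contradiction | linarith

theorem weightedSum_alternating_sub (a b : Fin q) (k : ℕ) :
    weightedSum (alternating a b (2 * k)) - weightedSum (alternating b a (2 * k)) =
      k * (((a : ℕ) : ℤ) - (b : ℕ)) := by
  induction k with
  | zero => simp [alternating]
  | succ k ih =>
    rw [show 2 * (k + 1) = 2 * k + 1 + 1 by ring]
    simp only [alternating, weightedSum, List.length_cons, length_alternating]
    push_cast
    linarith

theorem eq_of_dvd_sub {a b : Fin q} (h : (q : ℤ) ∣ ((a : ℕ) : ℤ) - (b : ℕ)) : a = b := by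
  have := Int.eq_zero_of_abs_lt_dvd h (by rw [abs_lt]; constructor <;> omega)
  omega

/-- An alternating swap of odd length changes the symbol sum modulo `q`, one of even length
below `K` changes the weighted sum modulo `q * K`. -/
theorem AlternatingSwap.false_of_dvd {k K : ℕ} (hk : 0 < k) (hkK : k < K) {x y : List (Fin q)}
    (h : AlternatingSwap k x y) (h₁ : (q : ℤ) ∣ symbolSum x - symbolSum y)
    (h₂ : (q : ℤ) * K ∣ weightedSum x - weightedSum y) : False := by
  obtain ⟨u, a, b, w, hab, rfl, rfl⟩ := h
  have hs := symbolSum_alternating_sub a b k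
  simp only [symbolSum_append] at h₁
  rw [show symbolSum u + (symbolSum (alternating a b k) + symbolSum w) -
    (symbolSum u + (symbolSum (alternating b a k) + symbolSum w)) =
    symbolSum (alternating a b k) - symbolSum (alternating b a k) by ring, hs] at h₁
  split_ifs at h₁ hs with he
  · obtain ⟨j, rfl⟩ := he.exists_two_nsmul
    rw [smul_eq_mul] at *
    simp only [weightedSum_append, List.length_append, length_alternating] at h₂
    rw [sub_eq_zero.1 hs] at h₂
    ring_nf at h₂
    rw [mul_comm j 2, ← mul_comm, mul_comm, weightedSum_alternating_sub] at h₂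
    have h0 := Int.eq_zero_of_abs_lt_dvd h₂ ?_
    · rcases mul_eq_zero.1 h0 with h0 | h0
      · omega
      · exact hab (Fin.ext (by omega))
    · rw [abs_mul, mul_comm]
      have h3 : |((a : ℕ) : ℤ) - (b : ℕ)| < q := by rw [abs_lt]; constructor <;> omega
      have h4 : |(j : ℤ)| < K := by rw [Nat.abs_cast]; omega
      exact mul_lt_mul'' h3 h4 (abs_nonneg _) (abs_nonneg _)
  · exact hab (eq_of_dvd_sub h₁)

/-! ### Codes as sets of lists -/

/-- The words of length `n`, as a set of lists. -/
def words (q n : ℕ) : Finset (List (Fin q)) :=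
  (Finset.univ : Finset (Word q n)).map ⟨List.Vector.toList, List.Vector.toList_injective⟩

@[simp] theorem mem_words {n : ℕ} {x : List (Fin q)} : x ∈ words q n ↔ x.length = n := by
  simp only [words, Finset.mem_map, Finset.mem_univ, true_and, Function.Embedding.coeFn_mk]
  exact ⟨fun ⟨v, hv⟩ => hv ▸ v.2, fun h => ⟨⟨x, h⟩, rfl⟩⟩

@[simp] theorem card_words (q n : ℕ) : (words q n).card = q ^ n := by
  simp [words, card_vector]

theorem isReconstructionCode_iff {n M : ℕ} {C : Finset (Word q n)} {B : ErrorBall q} :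
    IsReconstructionCode C (M + 1) B ↔
      ∀ x ∈ C, ∀ y ∈ C, x ≠ y → (B x.toList ∩ B y.toList).encard ≤ M := by
  rw [IsReconstructionCode, readCoverage, Nat.cast_add, Nat.cast_one,
    ENat.lt_add_one_iff (ENat.natCast_ne_top M)]
  simp only [iSup_le_iff]

theorem exists_words_of_isReconstructionCode {n M : ℕ} {C : Finset (Word q n)} {B : ErrorBall q}
    (h : IsReconstructionCode C (M + 1) B) :
    ∃ L ⊆ words q n, L.card = C.card ∧
      ∀ x ∈ L, ∀ y ∈ L, x ≠ y → (B x ∩ B y).encard ≤ M := by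
  refine ⟨C.map ⟨List.Vector.toList, List.Vector.toList_injective⟩,
    Finset.map_subset_map.2 (Finset.subset_univ C), Finset.card_map _, ?_⟩
  rw [isReconstructionCode_iff] at h
  simp only [Finset.mem_map, Function.Embedding.coeFn_mk]
  rintro _ ⟨x, hx, rfl⟩ _ ⟨y, hy, rfl⟩ hxy
  exact h x hx y hy fun h => hxy (h ▸ rfl)

theorem exists_isReconstructionCode_of_words {n M : ℕ} {L : Finset (List (Fin q))}
    (hL : L ⊆ words q n) {B : ErrorBall q}
    (h : ∀ x ∈ L, ∀ y ∈ L, x ≠ y → (B x ∩ B y).encard ≤ M) :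
    ∃ C : Finset (Word q n), C.card = L.card ∧ IsReconstructionCode C (M + 1) B := by
  classical
  refine ⟨Finset.univ.filter fun x => x.toList ∈ L, ?_, ?_⟩
  · rw [← Finset.card_map ⟨List.Vector.toList, List.Vector.toList_injective⟩]
    congr 1
    ext x
    simp only [Finset.mem_map, Finset.mem_filter, Finset.mem_univ, true_and,
      Function.Embedding.coeFn_mk]
    constructor
    · rintro ⟨v, hv, rfl⟩; exact hv
    · intro hx; exact ⟨⟨x, mem_words.1 (hL hx)⟩, hx, rfl⟩
  · rw [isReconstructionCode_iff]
    intro x hx y hy hxy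
    exact h _ (Finset.mem_filter.1 hx).2 _ (Finset.mem_filter.1 hy).2
      fun h => hxy (List.Vector.toList_injective h)

theorem card_le_pow {n : ℕ} (C : Finset (Word q n)) : C.card ≤ q ^ n := by
  simpa [card_vector] using Finset.card_le_univ C

/-! ### Codes with disjoint balls -/

theorem card_mul_le_of_disjoint {n : ℕ} (hq : 2 ≤ q) {L : Finset (List (Fin q))}
    (hL : L ⊆ words q n)
    (h : ∀ x ∈ L, ∀ y ∈ L, x ≠ y → (insDelBall q x ∩ insDelBall q y).encard ≤ 1) :
    L.card * (n + 1) ≤ q ^ (n + 1) := by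
  classical
  choose S hS hSc using exists_finset_subset_insBall (q := q) hq
  have hdisj : (L : Set (List (Fin q))).PairwiseDisjoint S := by
    intro x hx y hy hxy
    rw [Function.onFun, Finset.disjoint_left]
    intro z hzx hzy
    have hl : x.length = y.length := (mem_words.1 (hL hx)).trans (mem_words.1 (hL hy)).symm
    have hI : (insBall q x ∩ insBall q y).Nonempty := ⟨z, hS x hzx, hS y hzy⟩
    have hD := delBall_inter_nonempty_of_insBall hl hxy hI
    have h1 := h x hx y hy hxy
    rw [encard_insDelBall_inter hl] at h1
    have h2 : (1 : ℕ∞) + 1 ≤ 1 := (add_le_add (Set.one_le_encard_iff_nonempty.2 hI)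
      (Set.one_le_encard_iff_nonempty.2 hD)).trans h1
    exact absurd h2 (by decide)
  calc L.card * (n + 1) = ∑ x ∈ L, (S x).card := by
        rw [Finset.sum_congr rfl fun x hx => by rw [hSc, mem_words.1 (hL hx)]]
        simp
    _ = (L.biUnion S).card := (Finset.card_biUnion hdisj).symm
    _ ≤ (words q (n + 1)).card := by
        refine Finset.card_le_card fun z hz => ?_
        obtain ⟨x, hx, hz⟩ := Finset.mem_biUnion.1 hz
        rw [mem_words, length_of_mem_insBall (hS x hz), mem_words.1 (hL hx)]
    _ = q ^ (n + 1) := card_words _ _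

/-- The pigeonhole principle for residues of integer-valued statistics. -/
theorem exists_subset_forall_dvd_sub {α : Type*} (G : Finset α) (f g h : α → ℤ) {k l m : ℕ}
    (hk : 0 < k) (hl : 0 < l) (hm : 0 < m) :
    ∃ L ⊆ G, (G.card : ℝ) ≤ k * l * m * L.card ∧ ∀ x ∈ L, ∀ y ∈ L,
      (k : ℤ) ∣ f x - f y ∧ (l : ℤ) ∣ g x - g y ∧ (m : ℤ) ∣ h x - h y := by
  classical
  have := NeZero.of_pos hk
  have := NeZero.of_pos hl
  have := NeZero.of_pos hm
  have hpos : (0 : ℝ) < k * l * m := by positivity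
  let F : α → ZMod k × ZMod l × ZMod m := fun x => (f x, g x, h x)
  obtain ⟨c, -, hc⟩ := Finset.exists_le_card_fiber_of_nsmul_le_card_of_maps_to
    (s := G) (t := Finset.univ) (f := F) (b := (G.card : ℝ) / (k * l * m))
    (fun _ _ => Finset.mem_univ _) Finset.univ_nonempty (by
      rw [nsmul_eq_mul, Finset.card_univ, Fintype.card_prod, Fintype.card_prod, ZMod.card,
        ZMod.card, ZMod.card]
      push_cast
      rw [← mul_assoc, mul_div_cancel₀ _ hpos.ne'])
  refine ⟨G.filter fun x => F x = c, Finset.filter_subset _ _, ?_, ?_⟩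
  · rwa [div_le_iff₀' hpos] at hc
  · intro x hx y hy
    have hxy : F y = F x := (Finset.mem_filter.1 hy).2.trans (Finset.mem_filter.1 hx).2.symm
    simp only [F, Prod.mk.injEq, ZMod.intCast_eq_intCast_iff_dvd_sub] at hxy
    exact hxy

theorem eq_of_delBall_inter_nonempty {n : ℕ} (hq : 0 < q) {x y : List (Fin q)}
    (hx : x.length = n) (h : (delBall q x ∩ delBall q y).Nonempty)
    (hs : (q : ℤ) ∣ symbolSum x - symbolSum y)
    (h2 : (2 : ℤ) ∣ descents (⟨0, hq⟩ :: x) - descents (⟨0, hq⟩ :: y))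
    (hd : ((n + 1 : ℕ) : ℤ) ∣
      weightedDescents (⟨0, hq⟩ :: x) - weightedDescents (⟨0, hq⟩ :: y)) : x = y := by
  have hy : y.length = n := by
    obtain ⟨z, h₁, h₂⟩ := h
    rw [← hx, length_of_mem_delBall h₁, length_of_mem_delBall h₂]
  -- the situation is symmetric in `x` and `y`
  wlog hxy : ∃ u a m b w, x = u ++ a :: (m ++ w) ∧ y = u ++ (m ++ b :: w) generalizing x y
  · obtain ⟨u, a, m, b, w, h' | h'⟩ := exists_move_of_delBall_inter h
    · exact absurd ⟨u, a, m, b, w, h'⟩ hxy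
    · refine (this hy ?_ ?_ ?_ ?_ hx ⟨u, a, m, b, w, h'⟩).symm
      · rwa [Set.inter_comm]
      all_goals rw [dvd_sub_comm]; assumption
  obtain ⟨u, a, m, b, w, rfl, rfl⟩ := hxy
  obtain rfl : a = b := by
    refine eq_of_dvd_sub ?_
    convert hs using 1
    simp only [symbolSum_append, symbolSum]
    ring
  obtain ⟨p, hp⟩ := exists_descents_append_sub ⟨0, hq⟩ u
  obtain ⟨h₁, h₂⟩ := hp (a :: (m ++ w)) (m ++ a :: w) (by simp; omega)
  rw [h₁] at h2
  rw [h₂] at hd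
  rw [move_eq_of_descents_modEq (M := ((n + 1 : ℕ) : ℤ)) ?_ h2 hd]
  simp only [List.length_append, List.length_cons] at hx
  omega

/-- A code of Varshamov–Tenengolts type with disjoint balls. -/
theorem exists_words_disjoint (hq : 0 < q) (n : ℕ) :
    ∃ L ⊆ words q n, (q : ℝ) ^ n ≤ q * 2 * (n + 1) * L.card ∧
      ∀ x ∈ L, ∀ y ∈ L, x ≠ y → (insDelBall q x ∩ insDelBall q y).encard ≤ 0 := by
  obtain ⟨L, hL, hc, h⟩ := exists_subset_forall_dvd_sub (words q n) symbolSum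
    (fun x => descents (⟨0, hq⟩ :: x)) (fun x => weightedDescents (⟨0, hq⟩ :: x))
    hq two_pos n.succ_pos
  refine ⟨L, hL, by simpa using hc, fun x hx y hy hxy => ?_⟩
  have hl : x.length = y.length := (mem_words.1 (hL hx)).trans (mem_words.1 (hL hy)).symm
  have hD : ¬ (delBall q x ∩ delBall q y).Nonempty := fun hD => by
    obtain ⟨h₁, h₂, h₃⟩ := h x hx y hy
    exact hxy (eq_of_delBall_inter_nonempty hq (mem_words.1 (hL hx)) hD h₁ h₂ h₃)
  have hI : ¬ (insBall q x ∩ insBall q y).Nonempty := fun hI =>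
    hD (delBall_inter_nonempty_of_insBall hl hxy hI)
  rw [encard_insDelBall_inter hl, Set.not_nonempty_iff_eq_empty.1 hI,
    Set.not_nonempty_iff_eq_empty.1 hD]
  simp

/-! ### Codes with at most two common reads -/

/-- Few words contain a long alternating factor. -/
theorem exists_finset_alternating (q n K : ℕ) : ∃ T ⊆ words q n,
    T.card * q ^ K ≤ (n + 1) * q ^ 2 * q ^ n ∧ ∀ x ∈ words q n, ∀ a b : Fin q,
      alternating a b K <:+: x → x ∈ T := by
  classical
  by_cases hK : K ≤ n
  · let f : (ℕ × (Fin q × Fin q)) × List (Fin q) → List (Fin q) := fun z =>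
      z.2.take z.1.1 ++ alternating z.1.2.1 z.1.2.2 K ++ z.2.drop z.1.1
    refine ⟨((Finset.range (n + 1) ×ˢ Finset.univ) ×ˢ words q (n - K)).image f, ?_, ?_, ?_⟩
    · intro x hx
      simp only [Finset.mem_image, Finset.mem_product, mem_words] at hx
      obtain ⟨z, ⟨-, hz⟩, rfl⟩ := hx
      have := congrArg List.length (List.take_append_drop z.1.1 z.2)
      rw [List.length_append, hz] at this
      rw [mem_words]
      simp only [f, List.length_append, length_alternating]
      omega
    · refine (Nat.mul_le_mul_right _ Finset.card_image_le).trans (le_of_eq ?_)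
      rw [Finset.card_product, Finset.card_product, card_words, Finset.card_range,
        Finset.card_univ, Fintype.card_prod, Fintype.card_fin, mul_assoc, ← pow_add,
        Nat.sub_add_cancel hK]
      ring
    · rintro x hx a b ⟨u, w, rfl⟩
      rw [mem_words] at hx
      simp only [List.length_append, length_alternating] at hx
      refine Finset.mem_image.2 ⟨((u.length, (a, b)), u ++ w), ?_, by simp [f]⟩
      simp only [Finset.mem_product, Finset.mem_range, Finset.mem_univ, mem_words,
        List.length_append, and_true]
      omega
  · refine ⟨∅, by simp, by simp, ?_⟩
    intro x hx a b h
    have := h.length_le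
    rw [mem_words] at hx
    rw [length_alternating] at this
    omega

theorem exists_words_encard_le_two (hq : 2 ≤ q) (n : ℕ) :
    ∃ L ⊆ words q n, (q : ℝ) ^ n ≤ 2 * q ^ 2 * (Nat.log q n + 4) * L.card ∧
      ∀ x ∈ L, ∀ y ∈ L, x ≠ y → (insDelBall q x ∩ insDelBall q y).encard ≤ 2 := by
  classical
  set K := Nat.log q n + 4 with hK
  obtain ⟨T, hT, hTc, hTa⟩ := exists_finset_alternating q n K
  have hq0 : 0 < q := by omega
  have hTn : 2 * T.card ≤ q ^ n := by
    have h1 : n + 1 ≤ q ^ (Nat.log q n + 1) := Nat.lt_pow_succ_log_self (by omega) n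
    have h2 : (n + 1) * q ^ 2 * 2 ≤ q ^ K := by
      calc (n + 1) * q ^ 2 * 2 ≤ q ^ (Nat.log q n + 1) * q ^ 2 * q := by gcongr
        _ = q ^ K := by rw [hK]; ring
    have h3 : (n + 1) * q ^ 2 * (2 * T.card) ≤ (n + 1) * q ^ 2 * q ^ n := by
      calc (n + 1) * q ^ 2 * (2 * T.card) = (n + 1) * q ^ 2 * 2 * T.card := by ring
        _ ≤ q ^ K * T.card := by gcongr
        _ ≤ _ := by rw [mul_comm]; exact hTc
    exact Nat.le_of_mul_le_mul_left h3 (by positivity)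
  obtain ⟨L, hL, hc, h⟩ := exists_subset_forall_dvd_sub (words q n \ T) symbolSum weightedSum
    (fun _ => 0) hq0 (show 0 < q * K by positivity) one_pos
  refine ⟨L, hL.trans Finset.sdiff_subset, ?_, fun x hx y hy hxy => ?_⟩
  · rw [Finset.card_sdiff_of_subset hT, card_words, Nat.cast_sub (by omega)] at hc
    have : (2 : ℝ) * T.card ≤ q ^ n := by exact_mod_cast hTn
    rw [hK] at hc
    push_cast at hc
    nlinarith
  · have hx' := Finset.mem_sdiff.1 (hL hx)
    have hy' := Finset.mem_sdiff.1 (hL hy)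
    have hl : x.length = y.length := (mem_words.1 hx'.1).trans (mem_words.1 hy'.1).symm
    have key : ∀ k, 0 < k → ¬ AlternatingSwap k x y := by
      intro k hk hsw
      obtain ⟨h₁, h₂, -⟩ := h x hx y hy
      refine hsw.false_of_dvd (K := K) hk ?_ h₁ (by exact_mod_cast h₂)
      by_contra hkK
      obtain ⟨u, a, b, w, -, rfl, -⟩ := hsw
      refine hx'.2 (hTa _ hx'.1 a b ?_)
      exact (alternating_prefix a b (not_lt.1 hkK)).isInfix.trans ⟨u, w, by simp⟩
    have h0 : ¬ (1 < (insBall q x ∩ insBall q y).encard ∨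
        1 < (delBall q x ∩ delBall q y).encard) := fun h0 => by
      obtain ⟨k, hk, hsw⟩ := exists_alternatingSwap hl hxy h0
      exact key k hk hsw
    rw [not_or, not_lt, not_lt] at h0
    rw [encard_insDelBall_inter hl]
    exact (add_le_add h0.1 h0.2).trans (by norm_num)

/-! ### Codes with at most three common reads -/

/-- Let `Λ` be a set of `s` words of length `m`, and let `C` be a set of words of length `N m + r`
containing no two words that differ in a single factor, both versions of which lie in `Λ`.
Cutting off the first `m` symbols, the density `g N` of `C` satisfies
`g N ≤ (1 - s / q ^ m) * g (N - 1) + 1 / q ^ m`: a given remainder is completed by at most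
one prefix from `Λ`. -/
theorem card_le_of_clique {m : ℕ} (hq : 0 < q) {Λ : Finset (List (Fin q))} (hΛ : Λ ⊆ words q m)
    (hΛ0 : Λ.Nonempty) (N r : ℕ) (C : Finset (List (Fin q))) (hC : C ⊆ words q (N * m + r))
    (h : ∀ v ∈ Λ, ∀ v' ∈ Λ, v ≠ v' → ∀ u w, u ++ (v ++ w) ∈ C → u ++ (v' ++ w) ∉ C) :
    (C.card : ℝ) ≤ q ^ (N * m + r) * (1 / Λ.card + (1 - Λ.card / q ^ m) ^ N) := by
  classical
  have hs : (0 : ℝ) < Λ.card := by exact_mod_cast hΛ0.card_pos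
  have hq' : (0 : ℝ) < q := by exact_mod_cast hq
  have hsq : Λ.card ≤ q ^ m := by simpa using Finset.card_le_card hΛ
  induction N generalizing C with
  | zero =>
    have h1 : (C.card : ℝ) ≤ q ^ (0 * m + r) := by
      exact_mod_cast (by simpa using Finset.card_le_card hC : C.card ≤ q ^ (0 * m + r))
    refine h1.trans (le_mul_of_one_le_right (by positivity) ?_)
    rw [pow_zero]
    have : (0 : ℝ) ≤ 1 / Λ.card := by positivity
    linarith
  | succ N ih =>
    -- `D b` is the set of the words `w` with `b ++ w ∈ C`
    let D : List (Fin q) → Finset (List (Fin q)) := fun b =>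
      (words q (N * m + r)).filter fun w => b ++ w ∈ C
    have hcard : C.card ≤ ∑ b ∈ words q m, (D b).card := by
      have hsub : C ⊆ (words q m).biUnion fun b => (D b).image (b ++ ·) := by
        intro x hx
        have hlen := mem_words.1 (hC hx)
        rw [add_mul] at hlen
        simp only [Finset.mem_biUnion, Finset.mem_image, D, Finset.mem_filter, mem_words]
        exact ⟨x.take m, by simp; omega, x.drop m, ⟨by simp; omega, by simpa using hx⟩, by simp⟩
      refine (Finset.card_le_card hsub).trans (Finset.card_biUnion_le.trans ?_)
      exact Finset.sum_le_sum fun b _ => Finset.card_image_le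
    have hD : ∀ b, ((D b).card : ℝ) ≤
        q ^ (N * m + r) * (1 / Λ.card + (1 - Λ.card / q ^ m) ^ N) := by
      intro b
      refine ih (D b) (Finset.filter_subset _ _) fun v hv v' hv' hne u w hw hw' => ?_
      refine h v hv v' hv' hne (b ++ u) w ?_ ?_
      · simpa using (Finset.mem_filter.1 hw).2
      · simpa using (Finset.mem_filter.1 hw').2
    have hΛD : ∑ b ∈ Λ, (D b).card ≤ q ^ (N * m + r) := by
      rw [← Finset.card_biUnion]
      · refine (Finset.card_le_card (t := words q (N * m + r)) ?_).trans (card_words _ _).le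
        exact Finset.biUnion_subset.2 fun b _ => Finset.filter_subset _ _
      · intro v hv v' hv' hne
        rw [Function.onFun, Finset.disjoint_left]
        intro w hw hw'
        exact h v hv v' hv' hne [] w (Finset.mem_filter.1 hw).2 (Finset.mem_filter.1 hw').2
    have hsplit : ∑ b ∈ words q m, (D b).card =
        ∑ b ∈ words q m \ Λ, (D b).card + ∑ b ∈ Λ, (D b).card :=
      (Finset.sum_sdiff hΛ).symm
    have hrest : ∑ b ∈ words q m \ Λ, ((D b).card : ℝ) ≤ (q ^ m - Λ.card) *
        (q ^ (N * m + r) * (1 / Λ.card + (1 - Λ.card / q ^ m) ^ N)) := by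
      refine (Finset.sum_le_card_nsmul _ _ _ fun b _ => hD b).trans (le_of_eq ?_)
      rw [nsmul_eq_mul, Finset.card_sdiff_of_subset hΛ, card_words, Nat.cast_sub hsq]
      push_cast
      rfl
    have hcard' : (C.card : ℝ) ≤ ∑ b ∈ words q m \ Λ, ((D b).card : ℝ) + q ^ (N * m + r) := by
      exact_mod_cast hcard.trans (hsplit.trans_le (Nat.add_le_add_left hΛD _))
    refine (hcard'.trans (add_le_add_left hrest _)).trans (le_of_eq ?_)
    rw [show (N + 1) * m + r = m + (N * m + r) by ring, pow_add _ m,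
      pow_succ _ N]
    have hqm : (q : ℝ) ^ m ≠ 0 := by positivity
    generalize (1 - (Λ.card : ℝ) / q ^ m) ^ N = P
    generalize (q : ℝ) ^ m = Q at *
    field_simp
    ring

/-- The words `(ab)^i (ba)^(k - i)`, for `i ≤ k`, pairwise differ by an alternating swap of length
at least two. -/
theorem exists_clique {α : Type*} [DecidableEq α] {a b : α} (hab : a ≠ b) (k : ℕ) :
    ∃ Λ : Finset (List α), Λ.card = k + 1 ∧ (∀ v ∈ Λ, v.length = 2 * k) ∧
      ∀ v ∈ Λ, ∀ v' ∈ Λ, v ≠ v' → ∃ l, 2 ≤ l ∧ AlternatingSwap l v v' := by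
  let f : ℕ → List α := fun i => alternating a b (2 * i) ++ alternating b a (2 * (k - i))
  have hf : ∀ i j, i < j → j ≤ k → AlternatingSwap (2 * (j - i)) (f i) (f j) := by
    intro i j hij hjk
    refine ⟨alternating a b (2 * i), b, a, alternating b a (2 * (k - j)), hab.symm, ?_, ?_⟩
    · rw [← alternating_two_mul_add]
      simp only [f]
      congr 2
      omega
    · rw [← List.append_assoc, ← alternating_two_mul_add]
      simp only [f]
      congr 2
      omega
  have hf' : ∀ i ∈ Finset.range (k + 1), ∀ j ∈ Finset.range (k + 1), i ≠ j →
      ∃ l, 2 ≤ l ∧ AlternatingSwap l (f i) (f j) := by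
    intro i hi j hj hij
    rw [Finset.mem_range] at hi hj
    rcases Nat.lt_or_gt_of_ne hij with hij | hij
    · exact ⟨_, by omega, hf i j hij (by omega)⟩
    · exact ⟨_, by omega, (hf j i hij (by omega)).symm⟩
  refine ⟨(Finset.range (k + 1)).image f, ?_, ?_, ?_⟩
  · rw [Finset.card_image_of_injOn, Finset.card_range]
    intro i hi j hj hij
    by_contra hne
    obtain ⟨l, hl, hsw⟩ := hf' i hi j hj hne
    exact hsw.ne (by omega) hij
  · intro v hv
    obtain ⟨i, hi, rfl⟩ := Finset.mem_image.1 hv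
    rw [Finset.mem_range] at hi
    simp only [f, List.length_append, length_alternating]
    omega
  · intro v hv v' hv' hne
    obtain ⟨i, hi, rfl⟩ := Finset.mem_image.1 hv
    obtain ⟨j, hj, rfl⟩ := Finset.mem_image.1 hv'
    exact hf' i hi j hj fun h => hne (h ▸ rfl)

theorem one_sub_pow_le_inv {t : ℝ} (ht0 : 0 ≤ t) (ht1 : t ≤ 1) (N : ℕ) :
    (1 - t) ^ N ≤ 1 / (1 + N * t) := by
  have h1 : 1 + N * t ≤ (1 + t) ^ N := one_add_mul_le_pow (by linarith) N
  have h2 : (1 - t) ^ N * (1 + t) ^ N ≤ 1 := by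
    rw [← mul_pow]
    exact pow_le_one₀ (mul_nonneg (by linarith) (by linarith)) (by nlinarith)
  have h3 : (0 : ℝ) < 1 + N * t := by positivity
  rw [le_div_iff₀ h3]
  exact (mul_le_mul_of_nonneg_left h1 (pow_nonneg (by linarith) N)).trans h2

theorem card_mul_log_le_of_encard_le_three {n : ℕ} (hq : 2 ≤ q) (hn : q ^ 4 ≤ n)
    {L : Finset (List (Fin q))} (hL : L ⊆ words q n)
    (h : ∀ x ∈ L, ∀ y ∈ L, x ≠ y → (insDelBall q x ∩ insDelBall q y).encard ≤ 3) :
    (L.card : ℝ) * (Nat.log q n + 1) ≤ 8 * q ^ n := by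
  classical
  -- blocks of length `2 * k` with `2 * k * q ^ (2 * k) ≤ n`: so there are at least `q ^ (2 * k)`
  -- disjoint blocks
  set k := Nat.log q n / 4 with hk
  have hn0 : n ≠ 0 := by have : 0 < q ^ 4 := by positivity
                         omega
  have hk1 : 1 ≤ k := by
    have := Nat.le_log_of_pow_le (by omega) hn
    omega
  have hblocks : q ^ (2 * k) ≤ n / (2 * k) := by
    rw [Nat.le_div_iff_mul_le (by omega)]
    calc q ^ (2 * k) * (2 * k) ≤ q ^ (2 * k) * q ^ (2 * k) :=
          Nat.mul_le_mul_left _ (Nat.lt_pow_self (by omega)).le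
      _ = q ^ (4 * k) := by rw [← pow_add]; ring_nf
      _ ≤ q ^ Nat.log q n := Nat.pow_le_pow_right (by omega) (by omega)
      _ ≤ n := Nat.pow_log_le_self q hn0
  obtain ⟨Λ, hΛc, hΛl, hΛ⟩ := exists_clique
    (show (⟨0, by omega⟩ : Fin q) ≠ ⟨1, by omega⟩ by simp) k
  have hΛs : Λ ⊆ words q (2 * k) := fun v hv => mem_words.2 (hΛl v hv)
  have hn' : n / (2 * k) * (2 * k) + n % (2 * k) = n := Nat.div_add_mod' n (2 * k)
  have hmain := card_le_of_clique (by omega) hΛs (Finset.card_pos.1 (by omega)) (n / (2 * k))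
    (n % (2 * k)) L (by rwa [hn']) (by
      intro v hv v' hv' hne u w hw hw'
      obtain ⟨l, hl, hsw⟩ := hΛ v hv v' hv' hne
      have hsw' := (hsw.append_right w).append_left u
      have h4 := (hsw'.four_le_encard hl).trans (h _ hw _ hw' (hsw'.ne (by omega)))
      exact absurd h4 (by decide))
  rw [hn', hΛc] at hmain
  have hq' : (0 : ℝ) < q := by positivity
  have hqm : (0 : ℝ) < q ^ (2 * k) := by positivity
  have hsq : (((k + 1 : ℕ) : ℝ)) ≤ q ^ (2 * k) := by
    have := Finset.card_le_card hΛs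
    rw [card_words, hΛc] at this
    exact_mod_cast this
  have hs : (0 : ℝ) < ((k + 1 : ℕ) : ℝ) := by positivity
  have hpow := one_sub_pow_le_inv (t := ((k + 1 : ℕ) : ℝ) / q ^ (2 * k)) (by positivity)
    ((div_le_one hqm).2 hsq) (n / (2 * k))
  have hNt : ((k + 1 : ℕ) : ℝ) ≤
      1 + ((n / (2 * k) : ℕ) : ℝ) * (((k + 1 : ℕ) : ℝ) / q ^ (2 * k)) := by
    have : (q : ℝ) ^ (2 * k) ≤ ((n / (2 * k) : ℕ) : ℝ) := by exact_mod_cast hblocks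
    calc ((k + 1 : ℕ) : ℝ) = q ^ (2 * k) * (((k + 1 : ℕ) : ℝ) / q ^ (2 * k)) := by field_simp
      _ ≤ ((n / (2 * k) : ℕ) : ℝ) * (((k + 1 : ℕ) : ℝ) / q ^ (2 * k)) := by gcongr
      _ ≤ _ := by linarith
  have hpow' := hpow.trans (one_div_le_one_div_of_le hs hNt)
  have hL2 : (L.card : ℝ) ≤ q ^ n * (2 / ((k + 1 : ℕ) : ℝ)) := by
    refine hmain.trans (mul_le_mul_of_nonneg_left ?_ (by positivity))
    calc _ ≤ 1 / ((k + 1 : ℕ) : ℝ) + 1 / ((k + 1 : ℕ) : ℝ) := by gcongr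
      _ = _ := by ring
  have hlog : (Nat.log q n : ℝ) + 1 ≤ 4 * ((k + 1 : ℕ) : ℝ) := by
    exact_mod_cast (by omega : Nat.log q n + 1 ≤ 4 * (k + 1))
  calc (L.card : ℝ) * (Nat.log q n + 1)
      ≤ q ^ n * (2 / ((k + 1 : ℕ) : ℝ)) * (4 * ((k + 1 : ℕ) : ℝ)) := by gcongr
    _ = 8 * q ^ n := by field_simp; norm_num

/-! ### Redundancy -/

/-- If the largest codes have size `q ^ n / g n` up to a constant factor, then the optimal
redundancy is `log_q (g n)` up to a bounded error. -/
theorem eqUpToThetaOne_redundancy {N : ℕ} (hq : 2 ≤ q) (hN : 0 < N) {B : ErrorBall q} {g : ℕ → ℝ}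
    {A : ℝ} (hA : 0 < A)
    (hle : ∀ᶠ n in Filter.atTop, ∀ C : Finset (Word q n), IsReconstructionCode C N B →
      (C.card : ℝ) * g n ≤ A * q ^ n)
    (hge : ∀ᶠ n in Filter.atTop, 0 < g n ∧ ∃ C : Finset (Word q n), IsReconstructionCode C N B ∧
      (q : ℝ) ^ n ≤ A * g n * C.card) :
    EqUpToThetaOne (fun n => redundancy n N B) (fun n => Real.logb q (g n)) := by
  have hq1 : (1 : ℝ) < q := by exact_mod_cast (by omega : 1 < q)
  have hq0 : (0 : ℝ) < q := by linarith
  refine ⟨fun _ => |Real.logb q A| + 1, ?_, ?_⟩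
  · exact Asymptotics.isTheta_const_const (by positivity) one_ne_zero
  · filter_upwards [hle, hge] with n hle ⟨hg, C, hC, hCc⟩
    have hmin := redundancy_isLeast (by omega : 0 < q) n N hN B
    have hpow : Real.logb q ((q : ℝ) ^ n) = n := by
      rw [Real.logb_pow, Real.logb_self_eq_one hq1, mul_one]
    have hqn : (0 : ℝ) < (q : ℝ) ^ n := by positivity
    constructor
    · obtain ⟨C', hne, hC', heq⟩ := hmin.1
      have hpos : (0 : ℝ) < C'.card := by exact_mod_cast hne.card_pos
      have hlog := Real.logb_le_logb_of_le hq1 (by positivity) (hle C' hC')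
      rw [Real.logb_mul hpos.ne' hg.ne', Real.logb_mul hA.ne' hqn.ne', hpow] at hlog
      rw [heq]
      have := le_abs_self (Real.logb q A)
      linarith
    · have hpos : (0 : ℝ) < C.card := by
        by_contra h0
        have : (C.card : ℝ) = 0 := le_antisymm (not_lt.1 h0) (Nat.cast_nonneg _)
        rw [this, mul_zero] at hCc
        linarith
      have hlog := Real.logb_le_logb_of_le hq1 hqn hCc
      rw [Real.logb_mul (by positivity) hpos.ne', Real.logb_mul hA.ne' hg.ne', hpow] at hlog
      have hle' := hmin.2 ⟨C, Finset.card_pos.1 (by exact_mod_cast hpos), hC, rfl⟩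
      have := le_abs_self (Real.logb q A)
      linarith

theorem IsReconstructionCode.mono {n N N' : ℕ} (h : N ≤ N') {C : Finset (Word q n)}
    {B : ErrorBall q} (hC : IsReconstructionCode C N B) : IsReconstructionCode C N' B :=
  lt_of_lt_of_le hC (by exact_mod_cast h)

theorem eqUpToThetaOne_of_one_or_two (hq : 2 ≤ q) {N : ℕ} (hN : N = 1 ∨ N = 2) :
    EqUpToThetaOne (fun n => redundancy n N (insDelBall q)) (fun n => Real.logb q n) := by
  have hq0 : (0 : ℝ) < q := by positivity
  refine eqUpToThetaOne_redundancy (g := fun n => (n : ℝ)) (A := 4 * q) hq (by omega)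
    (by positivity) (Filter.Eventually.of_forall fun n C hC => ?_) ?_
  · obtain ⟨L, hL, hc, h⟩ := exists_words_of_isReconstructionCode (M := 1) (hC.mono (by omega))
    have := card_mul_le_of_disjoint hq hL h
    rw [hc] at this
    have h' : (C.card : ℝ) * (n + 1) ≤ q ^ (n + 1) := by exact_mod_cast this
    have hqn : (0 : ℝ) ≤ q * q ^ n := by positivity
    have hC0 : (0 : ℝ) ≤ C.card := by positivity
    rw [pow_succ'] at h'
    linarith
  · filter_upwards [Filter.eventually_ge_atTop 1] with n hn
    have hn' : (1 : ℝ) ≤ n := by exact_mod_cast hn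
    refine ⟨by linarith, ?_⟩
    obtain ⟨L, hL, hc, h⟩ := exists_words_disjoint (by omega : 0 < q) n
    obtain ⟨C, hCL, hC⟩ := exists_isReconstructionCode_of_words (M := 0) hL h
    refine ⟨C, hC.mono (by omega), hc.trans ?_⟩
    rw [hCL]
    refine mul_le_mul_of_nonneg_right ?_ (Nat.cast_nonneg _)
    nlinarith

theorem eqUpToThetaOne_of_three_or_four (hq : 2 ≤ q) {N : ℕ} (hN : N = 3 ∨ N = 4) :
    EqUpToThetaOne (fun n => redundancy n N (insDelBall q))
      (fun n => Real.logb q (Real.logb q n)) := by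
  have hq0 : (0 : ℝ) < q := by positivity
  have hq2 : (2 : ℝ) ≤ q := by exact_mod_cast hq
  refine eqUpToThetaOne_redundancy (g := fun n => Real.logb q n) (A := 10 * q ^ 2) hq (by omega)
    (by positivity) ?_ ?_
  · filter_upwards [Filter.eventually_ge_atTop (q ^ 4)] with n hn C hC
    obtain ⟨L, hL, hc, h⟩ := exists_words_of_isReconstructionCode (M := 3) (hC.mono (by omega))
    have h' := card_mul_log_le_of_encard_le_three hq hn hL h
    have hlog : Real.logb q n ≤ Nat.log q n + 1 := by
      rw [← Real.natFloor_logb_natCast q n]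
      exact (Nat.lt_floor_add_one _).le
    rw [hc] at h'
    calc (C.card : ℝ) * Real.logb q n ≤ C.card * (Nat.log q n + 1) := by gcongr
      _ ≤ 8 * q ^ n := h'
      _ ≤ 10 * q ^ 2 * q ^ n := by gcongr; nlinarith
  · filter_upwards [Filter.eventually_ge_atTop q] with n hn
    have hq1 : (1 : ℝ) < q := by linarith
    have hn0 : (0 : ℝ) < n := by exact_mod_cast (by omega : 0 < n)
    have hlog1 : (1 : ℝ) ≤ Real.logb q n := by
      rw [Real.le_logb_iff_rpow_le hq1 hn0, Real.rpow_one]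
      exact_mod_cast hn
    have hlog : (Nat.log q n : ℝ) ≤ Real.logb q n := Real.natLog_le_logb n q
    refine ⟨by linarith, ?_⟩
    obtain ⟨L, hL, hc, h⟩ := exists_words_encard_le_two hq n
    obtain ⟨C, hCL, hC⟩ := exists_isReconstructionCode_of_words (M := 2) hL h
    refine ⟨C, hC.mono (by omega), hc.trans ?_⟩
    rw [hCL]
    refine mul_le_mul_of_nonneg_right ?_ (Nat.cast_nonneg _)
    nlinarith [sq_nonneg (q : ℝ)]

theorem redundancy_eq_zero_of_five_le (hq : 2 ≤ q) {N : ℕ} (hN : 5 ≤ N) (n : ℕ) :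
    redundancy n N (insDelBall q) = 0 := by
  have hq1 : (1 : ℝ) < q := by exact_mod_cast (by omega : 1 < q)
  have hpow : Real.logb q ((q : ℝ) ^ n) = n := by
    rw [Real.logb_pow, Real.logb_self_eq_one hq1, mul_one]
  have hmin := redundancy_isLeast (by omega : 0 < q) n N (by omega) (insDelBall q)
  apply le_antisymm
  · have hcode : IsReconstructionCode (Finset.univ : Finset (Word q n)) (4 + 1) (insDelBall q) := by
      rw [isReconstructionCode_iff]
      intro x _ y _ hxy
      have hl : x.toList.length = y.toList.length := by simp
      have hne : x.toList ≠ y.toList := fun h => hxy (List.Vector.toList_injective h)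
      rw [encard_insDelBall_inter hl]
      exact (add_le_add (encard_insBall_inter_le_two hl hne)
        (encard_delBall_inter_le_two hl hne)).trans (by norm_num)
    refine hmin.2 ⟨Finset.univ, ?_, hcode.mono hN, ?_⟩
    · exact ⟨List.Vector.replicate n ⟨0, by omega⟩, Finset.mem_univ _⟩
    · rw [Finset.card_univ, card_vector, Fintype.card_fin, Nat.cast_pow, hpow, sub_self]
  · obtain ⟨C, hne, -, heq⟩ := hmin.1
    have hlog := Real.logb_le_logb_of_le hq1 (by exact_mod_cast hne.card_pos)
      (by exact_mod_cast card_le_pow C : (C.card : ℝ) ≤ (q : ℝ) ^ n)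
    rw [hpow] at hlog
    rw [heq]
    linarith

end SeqRecon

theorem mainTheorem9 (q : ℕ) (hq : 2 ≤ q) :
    (∀ N : ℕ, N = 1 ∨ N = 2 →
      SeqRecon.EqUpToThetaOne
        (fun n => SeqRecon.redundancy n N (SeqRecon.insDelBall q))
        (fun n => Real.logb (q : ℝ) (n : ℝ))) ∧
    (∀ N : ℕ, N = 3 ∨ N = 4 →
      SeqRecon.EqUpToThetaOne
        (fun n => SeqRecon.redundancy n N (SeqRecon.insDelBall q))
        (fun n => Real.logb (q : ℝ) (Real.logb (q : ℝ) (n : ℝ)))) ∧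
    (∀ N : ℕ, 5 ≤ N → ∀ n : ℕ,
      SeqRecon.redundancy n N (SeqRecon.insDelBall q) = 0) :=
  ⟨fun _ hN => SeqRecon.eqUpToThetaOne_of_one_or_two hq hN,
    fun _ hN => SeqRecon.eqUpToThetaOne_of_three_or_four hq hN,
    fun _ hN n => SeqRecon.redundancy_eq_zero_of_five_le hq hN n⟩
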